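/- Let $(M,\omega)$ be a symplectic manifold (finite-dimensional, smooth, Hausdorff, paracompact) and let $G$ be a finite-dimensional (Hausdorff, paracompact, not necessarily connected) Lie group with Lie algebra $\mathfrak g$, acting smoothly on $M$ by symplectomorphisms. For $\xi\in\mathfrak g$ let $\underline\xi$ be the fundamental vector field $\underline\xi_x=\frac{d}{dt}\big|_{t=0}\exp(-t\xi)x$. For $f\in C^\infty(M)$ let $v_f$ be its Hamiltonian vector field, $df=-\iota_{v_f}\omega$, and let $\{f,h\}=\omega(v_f,v_h)$ be the Poisson bracket. Suppose that the action is Hamiltonian with moment map $\mu:M\to\mathfrak g^*$, that is, $\mu$ is smooth, $d\mu_\xi=-\iota_{\underline\xi}\omega$ for all $\xi\in\mathfrak g$, where $\mu_\xi=\langle\mu,\xi\rangle$, and $\mu$ is equivariant for the coadjoint action. Put $N=\mu^{-1}(0)$ and let - $I_N\subset C^\infty(M)$ be the ideal of functions vanishing on $N$, and $I_\mu\subset C^\infty(M)$ the ideal generated by the functions $\mu_\xi$, $\xi\in\mathfrak g$; - $F_N=\{f\in C^\infty(M) : \{f,I_N\}\subset I_N\}$ be the space of first class functions; - $C^\infty(M)^G$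 be the algebra of $G$-invariant smooth functions and $I_N^G=I_N\cap C^\infty(M)^G$; the *ACG reduction* is $C^\infty(M)^G/I_N^G$; - $\mathfrak X_{\mathfrak g}(M)$ be the $C^\infty(M)$-submodule of $\mathfrak X(M)$ generated by the $\underline\xi$, and $I_{\mathfrak X}(N)=\{v\in\mathfrak X(M) : v\,C^\infty(M)\subset I_N\}$; - $L_\infty(M,\omega)_{[N]}\subset C^\infty(M)$ be the algebra of those $f$ such that $\underline\xi f\in I_N$ and $[v_f,\underline\xi]\in\mathfrak X_{\mathfrak g}(M)+I_{\mathfrak X}(N)$ for all $\xi\in\mathfrak g$, and $v_f I_N\subset I_N$; - $I_{L_\infty}(N)\subset L_\infty(M,\omega)_{[N]}$ be the ideal of those $f$ with in addition $f\in I_N$ and $v_f\in\mathfrak X_{\mathfrak g}(M)+I_{\mathfrak X}(N)$; the *$L_\infty$-reduction* is $L_\infty(M,\omega)_{[N]}/I_{L_\infty}(N)$. Assume that $I_\mu=I_N$. Then the Poisson bracket of $C^\infty(M)$ induces Poisson algebra structures on the ACG reduction and on the $L_\infty$-reduction; every $G$-invariant function belongs to $L_\infty(M,\omega)_{[N]}$,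 and $[f]\mapsto[f]$ is a well-defined injective homomorphism of Poisson algebras $$C^\infty(M)^G/I_N^G\;\hookrightarrow\; L_\infty(M,\omega)_{[N]}/I_{L_\infty}(N).$$ If moreover $F_N=C^\infty(M)^G+I_N$, then this homomorphism is an isomorphism of Poisson algebras. -/

import Mathlib

set_option linter.unusedSectionVars false
open scoped Manifold ContDiff Bundle Pointwise
open Bundle VectorField

noncomputable section

namespace SymplecticReduction

/-! ### Smooth functions and smooth vector fields -/

section Fields

variable {E : Type*} [NormedAddCommGroup E] [NormedSpace ℝ E]
variable {M : Type*} [TopologicalSpace M] [ChartedSpace E M]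

/-- The algebra of smooth real functions on `M`. -/
abbrev SmoothFun (E : Type*) [NormedAddCommGroup E] [NormedSpace ℝ E]
    (M : Type*) [TopologicalSpace M] [ChartedSpace E M] : Type _ :=
  ContMDiffMap 𝓘(ℝ, E) 𝓘(ℝ, ℝ) M ℝ ∞

variable [IsManifold 𝓘(ℝ, E) ∞ M]

/-- Smooth vector fields on `M`: smooth sections of the tangent bundle. -/
abbrev VField (E : Type*) [NormedAddCommGroup E] [NormedSpace ℝ E]
    (M : Type*) [TopologicalSpace M] [ChartedSpace E M] [IsManifold 𝓘(ℝ, E) ∞ M] : Type _ :=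
  ContMDiffSection 𝓘(ℝ, E) E ∞ (TangentSpace 𝓘(ℝ, E) : M → Type _)

/-- The module structure of vector fields over smooth functions, `(f • v) x = f x • v x`. -/
instance : Module (SmoothFun E M) (VField E M) where
  smul f v := ⟨fun x => f x • v x, f.contMDiff.smul_section v.contMDiff⟩
  one_smul v := by ext x; exact one_smul ℝ (v x)
  mul_smul f g v := by ext x; exact mul_smul (f x) (g x) (v x)
  smul_zero f := by ext x; exact smul_zero (f x)
  smul_add f v w := by ext x; exact smul_add (f x) (v x) (w x)
  add_smul f g v := by ext x; exact add_smul (f x) (g x) (v x)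
  zero_smul v := by ext x; exact zero_smul ℝ (v x)

theorem VField.smul_apply (f : SmoothFun E M) (v : VField E M) (x : M) :
    (f • v) x = f x • v x := rfl

theorem contMDiff_mvfderiv_apply (f : SmoothFun E M) (v : VField E M) :
    ContMDiff 𝓘(ℝ, E) 𝓘(ℝ, ℝ) ∞ (fun x => mvfderiv 𝓘(ℝ, E) f x (v x)) := by
  have h1 : ContMDiff 𝓘(ℝ, E).tangent 𝓘(ℝ, ℝ).tangent ∞
      (tangentMap 𝓘(ℝ, E) 𝓘(ℝ, ℝ) f) :=
    ContMDiff.contMDiff_tangentMap f.contMDiff (by simp)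
  exact (contMDiff_snd_tangentBundle_modelSpace ℝ 𝓘(ℝ, ℝ)).comp (h1.comp v.contMDiff)

/-- The derivative `v f` of the function `f` along the vector field `v`. -/
def lieDeriv (v : VField E M) (f : SmoothFun E M) : SmoothFun E M :=
  ⟨fun x => mvfderiv 𝓘(ℝ, E) f x (v x), contMDiff_mvfderiv_apply f v⟩

/-- The Lie bracket `[v, w]` of vector fields, with `[v, w] f = v (w f) - w (v f)`. -/
def lieBracket [CompleteSpace E] (v w : VField E M) : VField E M :=
  ⟨mlieBracket 𝓘(ℝ, E) v w, by
    have h2 : IsManifold 𝓘(ℝ, E) (minSmoothness ℝ 2) M :=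
      IsManifold.of_le (n := ∞) (by
        rw [minSmoothness_of_isRCLikeNormedField]; exact ENat.LEInfty.out)
    have : IsManifold 𝓘(ℝ, E) (((⊤ : ℕ∞) : WithTop ℕ∞) + 1) M := by
      simpa using (inferInstance : IsManifold 𝓘(ℝ, E) ∞ M)
    exact ContDiff.mlieBracket_vectorField (m := ⊤) (n := ⊤) v.contMDiff w.contMDiff (by simp)⟩

theorem lieDeriv_add_left (v w : VField E M) (f : SmoothFun E M) :
    lieDeriv (v + w) f = lieDeriv v f + lieDeriv w f := by
  ext x; exact map_add (mvfderiv 𝓘(ℝ, E) f x) (v x) (w x)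

theorem lieDeriv_smul_left (g : SmoothFun E M) (v : VField E M) (f : SmoothFun E M) :
    lieDeriv (g • v) f = g * lieDeriv v f := by
  ext x; exact map_smul (mvfderiv 𝓘(ℝ, E) f x) (g x) (v x)

theorem mvfderiv_add_apply (f g : SmoothFun E M) (x : M) (u : TangentSpace 𝓘(ℝ, E) x) :
    mvfderiv 𝓘(ℝ, E) (f + g : SmoothFun E M) x u =
      mvfderiv 𝓘(ℝ, E) f x u + mvfderiv 𝓘(ℝ, E) g x u := by
  have h := mvfderiv_add (f.mdifferentiableAt (x := x)) (g.mdifferentiableAt (x := x))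
  exact congrArg (fun T => T u) h

theorem mvfderiv_mul_apply (f g : SmoothFun E M) (x : M) (u : TangentSpace 𝓘(ℝ, E) x) :
    mvfderiv 𝓘(ℝ, E) (f * g : SmoothFun E M) x u =
      f x * mvfderiv 𝓘(ℝ, E) g x u + g x * mvfderiv 𝓘(ℝ, E) f x u := by
  have h := mvfderiv_mul (f.mdifferentiableAt (x := x)) (g.mdifferentiableAt (x := x))
  have h1 := congrArg (fun T => T u) h
  simpa using h1

theorem lieDeriv_add_right (v : VField E M) (f g : SmoothFun E M) :
    lieDeriv v (f + g) = lieDeriv v f + lieDeriv v g := by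
  ext x; exact mvfderiv_add_apply f g x (v x)

theorem lieDeriv_mul_right (v : VField E M) (f g : SmoothFun E M) :
    lieDeriv v (f * g) = f * lieDeriv v g + g * lieDeriv v f := by
  ext x; exact mvfderiv_mul_apply f g x (v x)

theorem lieBracket_add_left [CompleteSpace E] (v w u : VField E M) :
    lieBracket (v + w) u = lieBracket v u + lieBracket w u := by
  ext x
  exact mlieBracket_add_left v.mdifferentiableAt w.mdifferentiableAt

theorem lieBracket_smul_left [CompleteSpace E] (f : SmoothFun E M) (v u : VField E M) :
    lieBracket (f • v) u = -(lieDeriv u f) • v + f • lieBracket v u := by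
  ext x
  have h := mlieBracket_smul_left (I := 𝓘(ℝ, E)) (W := u) (f.mdifferentiableAt (x := x))
    (v.mdifferentiableAt (x := x))
  exact h

theorem lieBracket_zero_left [CompleteSpace E] (u : VField E M) :
    lieBracket (0 : VField E M) u = 0 := by
  ext x
  exact congrFun (mlieBracket_zero_left (I := 𝓘(ℝ, E)) (W := u)) x

end Fields

/-! ### Symplectic forms, Hamiltonian vector fields and the Poisson bracket -/

/-- A symplectic form on `M`: a smooth, alternating, nondegenerate and closed two-form.
Closedness is `dω (u, v, w) = 0` for all vector fields, with `dω` given by the invariant formula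
for the exterior derivative. -/
structure SymplecticForm (E : Type*) [NormedAddCommGroup E] [NormedSpace ℝ E] [CompleteSpace E]
    (M : Type*) [TopologicalSpace M] [ChartedSpace E M] [IsManifold 𝓘(ℝ, E) ∞ M] where
  /-- the bilinear form on each tangent space -/
  form (x : M) : TangentSpace 𝓘(ℝ, E) x →L[ℝ] TangentSpace 𝓘(ℝ, E) x →L[ℝ] ℝ
  smooth : ContMDiff 𝓘(ℝ, E) (𝓘(ℝ, E).prod 𝓘(ℝ, E →L[ℝ] E →L[ℝ] ℝ)) ∞
    (fun x => TotalSpace.mk' (E →L[ℝ] E →L[ℝ] ℝ)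
      (E := fun x : M => TangentSpace 𝓘(ℝ, E) x →L[ℝ] TangentSpace 𝓘(ℝ, E) x →L[ℝ] ℝ) x (form x))
  alternating (x : M) (u : TangentSpace 𝓘(ℝ, E) x) : form x u u = 0
  nondegenerate (x : M) (u : TangentSpace 𝓘(ℝ, E) x) : (∀ v, form x u v = 0) → u = 0
  closed (u v w : VField E M) (x : M) :
    mvfderiv 𝓘(ℝ, E) (fun y => form y (v y) (w y)) x (u x)
      - mvfderiv 𝓘(ℝ, E) (fun y => form y (u y) (w y)) x (v x)
      + mvfderiv 𝓘(ℝ, E) (fun y => form y (u y) (v y)) x (w x)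
      - form x (lieBracket u v x) (w x)
      + form x (lieBracket u w x) (v x)
      - form x (lieBracket v w x) (u x) = 0

section Poisson

variable {E : Type*} [NormedAddCommGroup E] [NormedSpace ℝ E] [FiniteDimensional ℝ E]
variable {M : Type*} [TopologicalSpace M] [ChartedSpace E M] [IsManifold 𝓘(ℝ, E) ∞ M]

namespace SymplecticForm

variable (Ω : SymplecticForm E M)

/-- `(v, f)` is a Hamiltonian pair: `df = - ι_v ω`. -/
def IsHamiltonianPair (v : VField E M) (f : SmoothFun E M) : Prop :=
  ∀ (x : M) (u : TangentSpace 𝓘(ℝ, E) x), mvfderiv 𝓘(ℝ, E) f x u = - Ω.form x (v x) u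

/-- The smooth function `ω (v, w)`. -/
def eval (v w : VField E M) : SmoothFun E M :=
  ⟨fun x => Ω.form x (v x) (w x), by
    have h := ContMDiff.clm_bundle_apply₂ (E₃ := Bundle.Trivial M ℝ) (F₃ := ℝ) (b := fun x : M => x)
      Ω.smooth v.contMDiff w.contMDiff
    exact fun x => (contMDiffAt_section x).1 (h x)⟩

theorem form_isInvertible (x : M) : (Ω.form x).IsInvertible := by
  let L : E →L[ℝ] (E →L[ℝ] ℝ) := Ω.form x
  have hinj : Function.Injective (L : E →ₗ[ℝ] (E →L[ℝ] ℝ)) := by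
    rw [← LinearMap.ker_eq_bot, LinearMap.ker_eq_bot']
    intro u hu
    refine Ω.nondegenerate x u fun v => ?_
    exact congrArg (fun T : E →L[ℝ] ℝ => T v) hu
  have hfr : Module.finrank ℝ E = Module.finrank ℝ (E →L[ℝ] ℝ) := by
    rw [← (LinearMap.toContinuousLinearMap (𝕜 := ℝ) (E := E) (F' := ℝ)).finrank_eq]
    exact (Subspace.dual_finrank_eq (K := ℝ) (V := E)).symm
  let e : E ≃ₗ[ℝ] (E →L[ℝ] ℝ) := LinearEquiv.ofInjectiveOfFinrankEq _ hinj hfr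
  exact ⟨e.toContinuousLinearEquiv, by ext u v; rfl⟩

theorem exists_isHamiltonianPair (f : SmoothFun E M) : ∃ v, Ω.IsHamiltonianPair v f := by
  let v : (x : M) → TangentSpace 𝓘(ℝ, E) x :=
    fun x => (Ω.form x).inverse (-(mvfderiv 𝓘(ℝ, E) f x))
  have hv (x : M) : Ω.form x (v x) = -(mvfderiv 𝓘(ℝ, E) f x) :=
    (Ω.form_isInvertible x).self_apply_inverse _
  refine ⟨⟨v, fun x₀ => ?_⟩, fun x u => ?_⟩
  swap
  · change _ = - Ω.form x (v x) u
    rw [hv]; simp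
  -- the form and the differential of `f`, read in the trivialization at `x₀`
  let A : M → (E →L[ℝ] E →L[ℝ] ℝ) := fun x =>
    ContinuousLinearMap.inCoordinates E (TangentSpace 𝓘(ℝ, E) : M → Type _) (E →L[ℝ] ℝ)
      (fun x : M => TangentSpace 𝓘(ℝ, E) x →L[ℝ] Bundle.Trivial M ℝ x) x₀ x x₀ x (Ω.form x)
  have hA : ContMDiffAt 𝓘(ℝ, E) 𝓘(ℝ, E →L[ℝ] E →L[ℝ] ℝ) ∞ A x₀ :=
    ((contMDiffAt_hom_bundle _).1 (Ω.smooth x₀)).2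
  let e := trivializationAt E (TangentSpace 𝓘(ℝ, E) : M → Type _) x₀
  have hx₀ : x₀ ∈ e.baseSet := FiberBundle.mem_baseSet_trivializationAt' x₀
  have hinv (x : M) (hx : x ∈ e.baseSet) : (A x).IsInvertible := by
    have hx' : x ∈ (trivializationAt (E →L[ℝ] ℝ)
        (fun x : M => TangentSpace 𝓘(ℝ, E) x →L[ℝ] Bundle.Trivial M ℝ x) x₀).baseSet := by
      rw [hom_trivializationAt_baseSet]; exact ⟨hx, by simp⟩
    simp only [A]
    rw [ContinuousLinearMap.inCoordinates_eq hx hx']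
    exact ContinuousLinearMap.isInvertible_equiv.comp
      ((Ω.form_isInvertible x).comp ContinuousLinearMap.isInvertible_equiv)
  let η : M → (E →L[ℝ] ℝ) := fun x => (mvfderiv 𝓘(ℝ, E) f x).comp (e.symmL ℝ x)
  have hη : ContMDiffAt 𝓘(ℝ, E) 𝓘(ℝ, E →L[ℝ] ℝ) ∞ η x₀ := by
    have h := ContMDiffAt.mfderiv_const (m := ∞) (f.contMDiff x₀) (by simp)
    refine h.congr_of_eventuallyEq (Filter.Eventually.of_forall fun x => ?_)
    change η x = ContinuousLinearMap.inCoordinates E (TangentSpace 𝓘(ℝ, E) : M → Type _) ℝ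
      (TangentSpace 𝓘(ℝ, ℝ) : ℝ → Type _) x₀ x (f x₀) (f x) (mfderiv 𝓘(ℝ, E) 𝓘(ℝ, ℝ) f x)
    ext u
    simp [η, e, mvfderiv, ContinuousLinearMap.inCoordinates]
    rfl
  have hloc : ∀ x ∈ e.baseSet, A x (e ⟨x, v x⟩).2 = -(η x) := by
    intro x hx
    ext u
    simp only [A]
    rw [inCoordinates_apply_eq₂ hx hx (by simp)]
    have h1 : (trivializationAt E (TangentSpace 𝓘(ℝ, E) : M → Type _) x₀).symm x
        (e ⟨x, v x⟩).2 = v x := e.symm_apply_apply_mk hx (v x)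
    rw [h1, hv]
    simp only [η, neg_apply, ContinuousLinearMap.comp_apply]
    change (trivializationAt ℝ (Bundle.Trivial M ℝ) x₀).linearMapAt ℝ x
      (-(mvfderiv 𝓘(ℝ, E) f x) (e.symm x u)) = _
    have h2 (r : ℝ) : (trivializationAt ℝ (Bundle.Trivial M ℝ) x₀).linearMapAt ℝ x r = r := by
      simp
    rw [h2, Trivialization.symmL_apply (R := ℝ) e hx]
  rw [contMDiffAt_section]
  have hB : ContMDiffAt 𝓘(ℝ, E) 𝓘(ℝ, E) ∞ (fun x => (A x).inverse (-(η x))) x₀ :=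
    ContMDiffAt.clm_apply
      (((hinv x₀ hx₀).contDiffAt_map_inverse.contMDiffAt (n := ∞)).comp x₀ hA) hη.neg
  refine hB.congr_of_eventuallyEq ?_
  filter_upwards [e.open_baseSet.mem_nhds hx₀] with x hx
  rw [← hloc x hx]
  exact ((hinv x hx).inverse_apply_self _).symm

/-- The Hamiltonian vector field of `f`: the unique `v` with `df = - ι_v ω`. -/
def hamField (f : SmoothFun E M) : VField E M := (Ω.exists_isHamiltonianPair f).choose

theorem isHamiltonianPair_iff (v : VField E M) (f : SmoothFun E M) :
    Ω.IsHamiltonianPair v f ↔ v = Ω.hamField f := by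
  have h := (Ω.exists_isHamiltonianPair f).choose_spec
  refine ⟨fun hv => ?_, fun hv => hv ▸ h⟩
  ext x
  rw [← sub_eq_zero]
  refine Ω.nondegenerate x _ fun u => ?_
  have h1 := hv x u
  have h2 := h x u
  rw [map_sub, sub_apply]
  unfold hamField
  linarith

variable {Ω} in
theorem IsHamiltonianPair.add {v w : VField E M} {f g : SmoothFun E M}
    (hv : Ω.IsHamiltonianPair v f) (hw : Ω.IsHamiltonianPair w g) :
    Ω.IsHamiltonianPair (v + w) (f + g) := by
  intro x u
  change _ = - Ω.form x (v x + w x) u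
  rw [mvfderiv_add_apply, hv x u, hw x u, map_add, add_apply]
  ring

variable {Ω} in
theorem IsHamiltonianPair.mul {v w : VField E M} {f g : SmoothFun E M}
    (hv : Ω.IsHamiltonianPair v f) (hw : Ω.IsHamiltonianPair w g) :
    Ω.IsHamiltonianPair (f • w + g • v) (f * g) := by
  intro x u
  change _ = - Ω.form x (f x • w x + g x • v x) u
  rw [mvfderiv_mul_apply, hv x u, hw x u, map_add, add_apply, map_smul, map_smul]
  change _ = -(f x * Ω.form x (w x) u + g x * Ω.form x (v x) u)
  ring

theorem isHamiltonianPair_const (c : ℝ) :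
    Ω.IsHamiltonianPair 0 (algebraMap ℝ (SmoothFun E M) c) := by
  intro x u
  change mvfderiv 𝓘(ℝ, E) (fun _ : M => c) x u = - Ω.form x 0 u
  rw [mvfderiv_const, map_zero]
  simp

/-- The Poisson bracket `{f, g} = ω (v_f, v_g)`. -/
def poisson (f g : SmoothFun E M) : SmoothFun E M := Ω.eval (Ω.hamField f) (Ω.hamField g)

end SymplecticForm

/-- The ideal `I_N` of smooth functions vanishing on `N`. -/
def vanishingIdeal (E : Type*) [NormedAddCommGroup E] [NormedSpace ℝ E]
    {M : Type*} [TopologicalSpace M] [ChartedSpace E M] (N : Set M) : Ideal (SmoothFun E M) where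
  carrier := {f | ∀ x ∈ N, f x = 0}
  add_mem' {f g} hf hg x hx := by
    change f x + g x = 0
    rw [hf x hx, hg x hx, add_zero]
  zero_mem' x _ := rfl
  smul_mem' f g hg x hx := by
    change f x * g x = 0
    rw [hg x hx, mul_zero]

/-- The first class functions `F_N = {f | {f, I_N} ⊆ I_N}`. -/
def SymplecticForm.firstClass (Ω : SymplecticForm E M) (N : Set M) : Set (SmoothFun E M) :=
  {f | ∀ h ∈ vanishingIdeal E N, Ω.poisson f h ∈ vanishingIdeal E N}

/-- The vector field `v` is tangent to `N`: `v I_N ⊆ I_N`. -/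
def IsTangentTo (N : Set M) (v : VField E M) : Prop :=
  ∀ h ∈ vanishingIdeal E N, lieDeriv v h ∈ vanishingIdeal E N

/-- The vector fields vanishing along `N`: those with `v C^∞(M) ⊆ I_N`. -/
def vanishingFields (E : Type*) [NormedAddCommGroup E] [NormedSpace ℝ E]
    {M : Type*} [TopologicalSpace M] [ChartedSpace E M] [IsManifold 𝓘(ℝ, E) ∞ M] (N : Set M) :
    Submodule (SmoothFun E M) (VField E M) where
  carrier := {v | ∀ f : SmoothFun E M, lieDeriv v f ∈ vanishingIdeal E N}
  add_mem' {v w} hv hw f x hx := by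
    have h1 : mvfderiv 𝓘(ℝ, E) f x (v x) = 0 := hv f x hx
    have h2 : mvfderiv 𝓘(ℝ, E) f x (w x) = 0 := hw f x hx
    change mvfderiv 𝓘(ℝ, E) f x (v x + w x) = 0
    rw [map_add, h1, h2, add_zero]
  zero_mem' f x _ := map_zero (mvfderiv 𝓘(ℝ, E) f x)
  smul_mem' g v hv f x hx := by
    have h1 : mvfderiv 𝓘(ℝ, E) f x (v x) = 0 := hv f x hx
    change mvfderiv 𝓘(ℝ, E) f x (g x • v x) = 0
    rw [map_smul, h1, smul_zero]

end Poisson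

/-! ### Lie group actions and moment maps -/

section Action

variable {E : Type*} [NormedAddCommGroup E] [NormedSpace ℝ E] [FiniteDimensional ℝ E]
variable {M : Type*} [TopologicalSpace M] [ChartedSpace E M] [IsManifold 𝓘(ℝ, E) ∞ M]
variable {F : Type*} [NormedAddCommGroup F] [NormedSpace ℝ F]
variable {G : Type*} [TopologicalSpace G] [ChartedSpace F G] [Group G] [LieGroup 𝓘(ℝ, F) ∞ G]
variable [MulAction G M] [ContMDiffSMul 𝓘(ℝ, F) 𝓘(ℝ, E) ∞ G M]

/-- The fundamental vector field of `ξ`, with the sign convention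
`x ↦ d/dt exp(-t ξ) x` at `t = 0`, which is minus the derivative at `1` of `g ↦ g x` in the
direction `ξ`. -/
def fundamentalField (ξ : GroupLieAlgebra 𝓘(ℝ, F) G) : VField E M :=
  ⟨fun x => -(mfderiv 𝓘(ℝ, F) 𝓘(ℝ, E) (fun g : G => g • x) 1 ξ : TangentSpace 𝓘(ℝ, E) x), by
    have : IsManifold 𝓘(ℝ, F) ∞ G := inferInstance
    have h1 : ContMDiff 𝓘(ℝ, E) 𝓘(ℝ, E).tangent ∞
        (fun x : M => (TotalSpace.mk' E x 0 : TangentBundle 𝓘(ℝ, E) M)) :=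
      contMDiff_zeroSection _ _
    have h2 : ContMDiff 𝓘(ℝ, E) 𝓘(ℝ, F).tangent ∞
        (fun _ : M => (TotalSpace.mk' F 1 ξ : TangentBundle 𝓘(ℝ, F) G)) := contMDiff_const
    have h3 : ContMDiff (𝓘(ℝ, F).prod 𝓘(ℝ, E)).tangent 𝓘(ℝ, E).tangent ∞
        (tangentMap (𝓘(ℝ, F).prod 𝓘(ℝ, E)) 𝓘(ℝ, E) (fun p : G × M => p.1 • p.2)) :=
      ContMDiff.contMDiff_tangentMap (n := ∞) contMDiff_smul (by simp)
    have h4 := h3.comp (contMDiff_equivTangentBundleProd_symm.comp (h2.prodMk h1))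
    have h5 : ContMDiff 𝓘(ℝ, E) 𝓘(ℝ, E).tangent ∞ (fun x : M => (TotalSpace.mk' E x
        (mfderiv 𝓘(ℝ, F) 𝓘(ℝ, E) (fun g : G => g • x) 1 ξ) : TangentBundle 𝓘(ℝ, E) M)) := by
      convert h4 using 1
      funext x
      refine TotalSpace.ext (one_smul G x).symm (heq_of_eq ?_)
      have h6 : MDifferentiableAt (𝓘(ℝ, F).prod 𝓘(ℝ, E)) 𝓘(ℝ, E)
          (fun p : G × M => p.1 • p.2) (1, x) :=
        (contMDiff_smul (I := 𝓘(ℝ, F)) (I' := 𝓘(ℝ, E)) (n := ∞)).mdifferentiableAt (by simp)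
      have h7 := mfderiv_prod_eq_add_apply (v := ((ξ, 0) : F × E)) h6
      refine Eq.trans ?_ h7.symm
      exact (add_zero _).symm.trans (congrArg _ (map_zero _).symm)
    exact h5.neg_section⟩

/-- The adjoint action of `g` on the Lie algebra: the derivative at `1` of `h ↦ g h g⁻¹`. -/
def adjoint (g : G) :
    GroupLieAlgebra 𝓘(ℝ, F) G → GroupLieAlgebra 𝓘(ℝ, F) G :=
  fun ξ => mfderiv 𝓘(ℝ, F) 𝓘(ℝ, F) (fun h : G => g * h * g⁻¹) 1 ξ

/-- The action of `G` preserves the symplectic form. -/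
def SymplecticForm.IsSymplecticAction (Ω : SymplecticForm E M) (G : Type*) [Group G]
    [MulAction G M] : Prop :=
  ∀ (g : G) (x : M) (u v : TangentSpace 𝓘(ℝ, E) x),
    Ω.form (g • x) (mfderiv 𝓘(ℝ, E) 𝓘(ℝ, E) (fun y : M => g • y) x u)
      (mfderiv 𝓘(ℝ, E) 𝓘(ℝ, E) (fun y : M => g • y) x v) = Ω.form x u v

/-- The component `μ_ξ = ⟨μ, ξ⟩` of a smooth map `μ` from `M` to the dual of the Lie algebra. As
the Lie algebra of `G` is the model space `F`, its dual is `F →L[ℝ] ℝ`. -/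
def component (μ : ContMDiffMap 𝓘(ℝ, E) 𝓘(ℝ, F →L[ℝ] ℝ) M (F →L[ℝ] ℝ) ∞)
    (ξ : GroupLieAlgebra 𝓘(ℝ, F) G) : SmoothFun E M :=
  ⟨fun x => μ x ξ, μ.contMDiff.clm_apply contMDiff_const⟩

/-- A moment map for the action of `G` on `(M, Ω)`: a smooth map `μ` to the dual of the Lie
algebra with `d μ_ξ = - ι_ξ Ω`, equivariant for the coadjoint action
`⟨g · λ, ξ⟩ = ⟨λ, Ad (g⁻¹) ξ⟩`. -/
structure MomentMap (Ω : SymplecticForm E M) (F : Type*) [NormedAddCommGroup F] [NormedSpace ℝ F]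
    (G : Type*) [TopologicalSpace G] [ChartedSpace F G] [Group G] [LieGroup 𝓘(ℝ, F) ∞ G]
    [MulAction G M] [ContMDiffSMul 𝓘(ℝ, F) 𝓘(ℝ, E) ∞ G M] where
  /-- the underlying smooth map -/
  toMap : ContMDiffMap 𝓘(ℝ, E) 𝓘(ℝ, F →L[ℝ] ℝ) M (F →L[ℝ] ℝ) ∞
  hamiltonian (ξ : GroupLieAlgebra 𝓘(ℝ, F) G) :
    Ω.IsHamiltonianPair (fundamentalField ξ) (component toMap ξ)
  equivariant (g : G) (x : M) (ξ : GroupLieAlgebra 𝓘(ℝ, F) G) :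
    toMap (g • x) ξ = toMap x (adjoint g⁻¹ ξ)

namespace MomentMap

variable {Ω : SymplecticForm E M} (μ : MomentMap Ω F G)

/-- The constraint set `N = μ⁻¹(0)`. -/
def zeroLocus : Set M := {x | μ.toMap x = 0}

/-- The momentum ideal `I_μ`: the ideal of smooth functions generated by all momenta `μ_ξ`. -/
def momentumIdeal : Ideal (SmoothFun E M) :=
  Ideal.span (Set.range fun ξ : GroupLieAlgebra 𝓘(ℝ, F) G => component μ.toMap ξ)

end MomentMap

/-! ### The Arms-Cushman-Gotay reduction -/

/-- The algebra of `G`-invariant smooth functions. -/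
def invariants (E : Type*) [NormedAddCommGroup E] [NormedSpace ℝ E]
    (M : Type*) [TopologicalSpace M] [ChartedSpace E M] (G : Type*) [Group G] [MulAction G M] :
    Subalgebra ℝ (SmoothFun E M) where
  carrier := {f | ∀ (g : G) (x : M), f (g • x) = f x}
  mul_mem' {f h} hf hh g x := by
    change f (g • x) * h (g • x) = f x * h x
    rw [hf, hh]
  add_mem' {f h} hf hh g x := by
    change f (g • x) + h (g • x) = f x + h x
    rw [hf, hh]
  algebraMap_mem' _ _ _ := rfl

/-- The ideal `I_N^G` of invariant smooth functions vanishing on `N`. -/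
def invariantVanishingIdeal (E : Type*) [NormedAddCommGroup E] [NormedSpace ℝ E]
    {M : Type*} [TopologicalSpace M] [ChartedSpace E M] (G : Type*) [Group G] [MulAction G M]
    (N : Set M) : Ideal (invariants E M G) :=
  (vanishingIdeal E N).comap (invariants E M G).val

/-- The algebra underlying the Arms-Cushman-Gotay reduction: invariant functions modulo invariant
functions vanishing on `N`. -/
abbrev ACGReduction (E : Type*) [NormedAddCommGroup E] [NormedSpace ℝ E]
    {M : Type*} [TopologicalSpace M] [ChartedSpace E M] (G : Type*) [Group G] [MulAction G M]
    (N : Set M) : Type _ :=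
  invariants E M G ⧸ invariantVanishingIdeal E G N

/-! ### The `L_∞`-reduction of a symplectic manifold -/

/-- The `C^∞(M)`-module of vector fields generated by the fundamental vector fields. -/
def fundamentalModule (E M F G : Type*) [NormedAddCommGroup E] [NormedSpace ℝ E]
    [FiniteDimensional ℝ E]
    [TopologicalSpace M] [ChartedSpace E M] [IsManifold 𝓘(ℝ, E) ∞ M]
    [NormedAddCommGroup F] [NormedSpace ℝ F]
    [TopologicalSpace G] [ChartedSpace F G] [Group G] [LieGroup 𝓘(ℝ, F) ∞ G]
    [MulAction G M] [ContMDiffSMul 𝓘(ℝ, F) 𝓘(ℝ, E) ∞ G M] :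
    Submodule (SmoothFun E M) (VField E M) :=
  Submodule.span _ (Set.range fun ξ : GroupLieAlgebra 𝓘(ℝ, F) G => fundamentalField ξ)

variable (F G) in
/-- A vector field `v` is reducible: it is tangent to `N`, and for each `ξ` the bracket of `v`
with the fundamental field of `ξ` is a sum of a member of the fundamental module and a field
vanishing along `N`. -/
def IsReducibleField (N : Set M) (v : VField E M) : Prop :=
  IsTangentTo N v ∧ ∀ ξ : GroupLieAlgebra 𝓘(ℝ, F) G,
    lieBracket v (fundamentalField ξ) ∈ fundamentalModule E M F G ⊔ vanishingFields E N

variable (F G) in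
/-- A smooth function is reducible as a `0`-form: its derivative along each fundamental vector
field vanishes on `N` (the contraction condition is void in degree zero). -/
def IsReducibleFun (N : Set M) (f : SmoothFun E M) : Prop :=
  ∀ ξ : GroupLieAlgebra 𝓘(ℝ, F) G, lieDeriv (fundamentalField ξ) f ∈ vanishingIdeal E N

section Observables

variable {N : Set M}

theorem smul_mem_vanishingFields {f : SmoothFun E M} (hf : f ∈ vanishingIdeal E N)
    (v : VField E M) : f • v ∈ vanishingFields E N := by
  intro h
  rw [lieDeriv_smul_left]
  exact Ideal.mul_mem_right _ _ hf

theorem IsReducibleField.zero : IsReducibleField F G N (0 : VField E M) := by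
  refine ⟨fun h _ => (vanishingFields E N).zero_mem h, fun ξ => ?_⟩
  rw [lieBracket_zero_left]
  exact Submodule.zero_mem _

theorem IsReducibleField.add {v w : VField E M} (hv : IsReducibleField F G N v)
    (hw : IsReducibleField F G N w) : IsReducibleField F G N (v + w) := by
  refine ⟨fun h hh => ?_, fun ξ => ?_⟩
  · rw [lieDeriv_add_left]
    exact Ideal.add_mem _ (hv.1 h hh) (hw.1 h hh)
  · rw [lieBracket_add_left]
    exact Submodule.add_mem _ (hv.2 ξ) (hw.2 ξ)

theorem IsReducibleField.smul {f : SmoothFun E M} {v : VField E M} (hf : IsReducibleFun F G N f)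
    (hv : IsReducibleField F G N v) : IsReducibleField F G N (f • v) := by
  refine ⟨fun h hh => ?_, fun ξ => ?_⟩
  · rw [lieDeriv_smul_left]
    exact Ideal.mul_mem_left _ _ (hv.1 h hh)
  · rw [lieBracket_smul_left]
    refine Submodule.add_mem _ (Submodule.mem_sup_right ?_) (Submodule.smul_mem _ _ (hv.2 ξ))
    exact smul_mem_vanishingFields (neg_mem (hf ξ)) v

theorem IsReducibleFun.add {f g : SmoothFun E M} (hf : IsReducibleFun F G N f)
    (hg : IsReducibleFun F G N g) : IsReducibleFun F G N (f + g) := by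
  intro ξ
  rw [lieDeriv_add_right]
  exact Ideal.add_mem _ (hf ξ) (hg ξ)

theorem IsReducibleFun.mul {f g : SmoothFun E M} (hf : IsReducibleFun F G N f)
    (hg : IsReducibleFun F G N g) : IsReducibleFun F G N (f * g) := by
  intro ξ
  rw [lieDeriv_mul_right]
  exact Ideal.add_mem _ (Ideal.mul_mem_left _ _ (hg ξ)) (Ideal.mul_mem_left _ _ (hf ξ))

theorem IsReducibleFun.const (c : ℝ) :
    IsReducibleFun F G N (algebraMap ℝ (SmoothFun E M) c) := by
  intro ξ x _
  change mvfderiv 𝓘(ℝ, E) (fun _ : M => c) x _ = 0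
  rw [mvfderiv_const]
  rfl

end Observables

/-- The reducible observables: the functions `f` that belong to a
Hamiltonian pair `(v, f)` with `v` and `f` reducible. -/
def reducibleObservables (Ω : SymplecticForm E M) (F G : Type*)
    [NormedAddCommGroup F] [NormedSpace ℝ F]
    [TopologicalSpace G] [ChartedSpace F G] [Group G] [LieGroup 𝓘(ℝ, F) ∞ G]
    [MulAction G M] [ContMDiffSMul 𝓘(ℝ, F) 𝓘(ℝ, E) ∞ G M] (N : Set M) :
    Subalgebra ℝ (SmoothFun E M) where
  carrier := {f | ∃ v : VField E M, Ω.IsHamiltonianPair v f ∧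
    IsReducibleField F G N v ∧ IsReducibleFun F G N f}
  mul_mem' := by
    rintro f g ⟨v, h1, h2, h3⟩ ⟨w, k1, k2, k3⟩
    exact ⟨f • w + g • v, h1.mul k1, (k2.smul h3).add (h2.smul k3), h3.mul k3⟩
  add_mem' := by
    rintro f g ⟨v, h1, h2, h3⟩ ⟨w, k1, k2, k3⟩
    exact ⟨v + w, h1.add k1, h2.add k2, h3.add k3⟩
  algebraMap_mem' c := ⟨0, Ω.isHamiltonianPair_const c, .zero, .const c⟩

/-- The vanishing observable ideal: the functions `f` that belong to a
Hamiltonian pair `(v, f)` of reducible observables where `f` vanishes on `N` and `v` is the sum of a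
member of the fundamental module and a vector field vanishing along `N`. -/
def vanishingObservables (Ω : SymplecticForm E M) (F G : Type*)
    [NormedAddCommGroup F] [NormedSpace ℝ F]
    [TopologicalSpace G] [ChartedSpace F G] [Group G] [LieGroup 𝓘(ℝ, F) ∞ G]
    [MulAction G M] [ContMDiffSMul 𝓘(ℝ, F) 𝓘(ℝ, E) ∞ G M] (N : Set M) :
    Ideal (reducibleObservables Ω F G N) where
  carrier := {f | ∃ v : VField E M, Ω.IsHamiltonianPair v f ∧
    IsReducibleField F G N v ∧ IsReducibleFun F G N (f : SmoothFun E M) ∧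
    v ∈ fundamentalModule E M F G ⊔ vanishingFields E N ∧
    (f : SmoothFun E M) ∈ vanishingIdeal E N}
  add_mem' := by
    rintro f g ⟨v, h1, h2, h3, h4, h5⟩ ⟨w, k1, k2, k3, k4, k5⟩
    exact ⟨v + w, h1.add k1, h2.add k2, h3.add k3, Submodule.add_mem _ h4 k4,
      Ideal.add_mem _ h5 k5⟩
  zero_mem' := by
    refine ⟨0, ?_, .zero, ?_, Submodule.zero_mem _, Submodule.zero_mem _⟩
    · simpa using Ω.isHamiltonianPair_const 0
    · simpa using IsReducibleFun.const (E := E) (M := M) (F := F) (G := G) (N := N) 0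
  smul_mem' := by
    rintro ⟨g, w, k1, k2, k3⟩ f ⟨v, h1, h2, h3, h4, h5⟩
    exact ⟨g • v + (f : SmoothFun E M) • w, k1.mul h1, (h2.smul k3).add (k2.smul h3), k3.mul h3,
      Submodule.add_mem _ (Submodule.smul_mem _ _ h4)
        (Submodule.mem_sup_right (smul_mem_vanishingFields h5 w)), Ideal.mul_mem_left _ _ h5⟩

/-- The algebra underlying the `L_∞`-reduction of `C^∞(M, Ω)` along `N`. In the symplectic case the
`L_∞`-algebra of `(M, Ω)` is concentrated in degree zero, where it is `C^∞(M)` with the Poisson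
bracket as its only multibracket. -/
abbrev LInftyReduction (Ω : SymplecticForm E M) (F G : Type*)
    [NormedAddCommGroup F] [NormedSpace ℝ F]
    [TopologicalSpace G] [ChartedSpace F G] [Group G] [LieGroup 𝓘(ℝ, F) ∞ G]
    [MulAction G M] [ContMDiffSMul 𝓘(ℝ, F) 𝓘(ℝ, E) ∞ G M] (N : Set M) : Type _ :=
  reducibleObservables Ω F G N ⧸ vanishingObservables Ω F G N

end Action

/-! ### Poisson algebras -/

/-- A Poisson bracket on a commutative real algebra: a Lie bracket that is a derivation in its
second argument (and hence in both). -/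
structure PoissonBracket (A : Type*) [CommRing A] [Algebra ℝ A] where
  /-- the bracket -/
  bracket : A →ₗ[ℝ] A →ₗ[ℝ] A
  self (a : A) : bracket a a = 0
  jacobi (a b c : A) :
    bracket a (bracket b c) + bracket b (bracket c a) + bracket c (bracket a b) = 0
  leibniz (a b c : A) : bracket a (b * c) = bracket a b * c + b * bracket a c

end SymplecticReduction

end

/-! The bracket `{f, g}` equals `v_f g`, so in each argument it is a derivation. Closedness of the
form, evaluated on three Hamiltonian fields, gives the Jacobi identity and hence `v_{f,g} = [v_f,
v_g]`. Both reductions are then quotients of a Poisson subalgebra of the smooth functions by a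
Poisson ideal.

For reducible observables, stability under the bracket follows from the Jacobi identities for fields
and functions: a reducible field preserves both `I_N` and the module of fields that are fundamental
up to fields vanishing on `N` (`IsReducibleField.lieBracket_mem`). For invariant functions,
Noether's identity `{f, μ_ξ} = 0` makes `{f, ·}` a derivation killing the generators of `I_μ`, so it
preserves `I_μ = I_N`; the same identity gives `[v_f, ξ] = 0`, whence invariant functions are
reducible (`invariants_le_reducibleObservables`).

The Hamiltonian field of an element of `I_μ` is, up to a field vanishing on `N`, a combination of
fundamental fields (`hamField_mem_of_mem_momentumIdeal`). So if `I_μ = I_N`, a reducible observable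
represents zero exactly when it vanishes on `N`. Both ideals are then the trace of `I_N`, which
gives a well-defined injective comparison map. Reducible observables are first class, so a
decomposition of first class functions as invariant plus vanishing gives surjectivity. -/

noncomputable section

namespace SymplecticReduction

/-! ### Lie brackets of vector fields as commutators of derivations. -/

section FieldCalculus

variable {E : Type*} [NormedAddCommGroup E] [NormedSpace ℝ E]
variable {M : Type*} [TopologicalSpace M] [ChartedSpace E M] [IsManifold 𝓘(ℝ, E) ∞ M]

theorem lieDeriv_apply (v : VField E M) (f : SmoothFun E M) (x : M) :
    lieDeriv v f x = mvfderiv 𝓘(ℝ, E) f x (v x) := rfl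

theorem lieDeriv_apply_eq_zero {v : VField E M} {x : M} (hv : v x = 0) (f : SmoothFun E M) :
    lieDeriv v f x = 0 := by
  rw [lieDeriv_apply, hv]
  exact map_zero (mvfderiv 𝓘(ℝ, E) f x)

variable [CompleteSpace E]

theorem lieBracket_swap (v w : VField E M) : lieBracket v w = -lieBracket w v := by
  ext x
  exact mlieBracket_swap_apply

theorem lieBracket_add_right (v w u : VField E M) :
    lieBracket v (w + u) = lieBracket v w + lieBracket v u := by
  ext x
  exact mlieBracket_add_right w.mdifferentiableAt u.mdifferentiableAt

theorem lieBracket_smul_right (f : SmoothFun E M) (v w : VField E M) :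
    lieBracket v (f • w) = lieDeriv v f • w + f • lieBracket v w := by
  ext x
  exact mlieBracket_smul_right (I := 𝓘(ℝ, E)) (V := v) (f.mdifferentiableAt (x := x))
    (w.mdifferentiableAt (x := x))

theorem lieBracket_lieBracket (u v w : VField E M) :
    lieBracket u (lieBracket v w) =
      lieBracket (lieBracket u v) w + lieBracket v (lieBracket u w) := by
  have h2 : minSmoothness ℝ 2 ≤ ∞ := by
    rw [minSmoothness_of_isRCLikeNormedField]; exact ENat.LEInfty.out
  have h3 : minSmoothness ℝ 3 ≤ ∞ := by
    rw [minSmoothness_of_isRCLikeNormedField]; exact ENat.LEInfty.out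
  have : IsManifold 𝓘(ℝ, E) (minSmoothness ℝ 3) M := IsManifold.of_le (n := ∞) h3
  ext x
  exact leibniz_identity_mlieBracket_apply (I := 𝓘(ℝ, E)) ((u.contMDiff x).of_le h2)
    ((v.contMDiff x).of_le h2) ((w.contMDiff x).of_le h2)

/-- The commutator defect of the Lie bracket annihilates every vector field. -/
theorem lieDeriv_lieBracket_smul (u v w : VField E M) (f : SmoothFun E M) :
    (lieDeriv (lieBracket u v) f) • w =
      (lieDeriv u (lieDeriv v f) - lieDeriv v (lieDeriv u f)) • w := by
  -- In the Jacobi identity for `f • w`, the mixed terms cancel and the terms with coefficient `f`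
  -- cancel by the identity for `w`; only multiples of `w` by second derivatives of `f` remain.
  have h := lieBracket_lieBracket u v (f • w)
  have h0 := lieBracket_lieBracket u v w
  simp only [lieBracket_smul_right, lieBracket_add_right] at h
  rw [h0, smul_add] at h
  rw [sub_smul]
  rw [← sub_eq_zero] at h ⊢
  rw [← neg_eq_zero, ← h]
  abel

/-- The Lie bracket of vector fields acts on functions as the commutator. -/
theorem lieDeriv_lieBracket (u v : VField E M) (f : SmoothFun E M) :
    lieDeriv (lieBracket u v) f = lieDeriv u (lieDeriv v f) - lieDeriv v (lieDeriv u f) := by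
  ext x
  -- Any field not vanishing at `x` can be cancelled there. Taking `u` or `v` itself avoids
  -- constructing such a field; if both vanish at `x`, so does their bracket, and both sides are
  -- zero.
  have key (w : VField E M) (hw : w x ≠ 0) : lieDeriv (lieBracket u v) f x =
      (lieDeriv u (lieDeriv v f) - lieDeriv v (lieDeriv u f)) x := by
    have h := congrArg (fun w : VField E M => w x) (lieDeriv_lieBracket_smul u v w f)
    exact smul_left_injective ℝ hw h
  by_cases hu : u x = 0
  · by_cases hv : v x = 0
    · have h0 : lieBracket u v x = 0 := by
        change mlieBracket 𝓘(ℝ, E) u v x = 0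
        rw [← mlieBracketWithin_univ]
        exact mlieBracketWithin_eq_zero_of_eq_zero hu hv
      rw [lieDeriv_apply_eq_zero h0]
      change 0 = lieDeriv u (lieDeriv v f) x - lieDeriv v (lieDeriv u f) x
      rw [lieDeriv_apply_eq_zero hu, lieDeriv_apply_eq_zero hv, sub_zero]
    · exact key v hv
  · exact key u hu

end FieldCalculus

/-! ### Smooth functions separate tangent vectors on a Hausdorff manifold. -/

section Separation

variable {E : Type*} [NormedAddCommGroup E] [NormedSpace ℝ E] [FiniteDimensional ℝ E]
variable {M : Type*} [TopologicalSpace M] [ChartedSpace E M] [IsManifold 𝓘(ℝ, E) ∞ M] [T2Space M]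

/-- Every covector at a point, read in the chart there, is the differential of a global smooth
function. -/
theorem exists_mvfderiv_eq (x : M) (ℓ : E →L[ℝ] ℝ) :
    ∃ f : SmoothFun E M, mvfderiv 𝓘(ℝ, E) f x =
      ℓ.comp (mfderiv 𝓘(ℝ, E) 𝓘(ℝ, E) (extChartAt 𝓘(ℝ, E) x) x) := by
  -- The cutoff makes the chart expression `ℓ ∘ extChartAt` global; being `1` near `x`, it leaves
  -- the differential there unchanged.
  let b : SmoothBumpFunction 𝓘(ℝ, E) x := Classical.arbitrary _
  have hc : ContMDiffOn 𝓘(ℝ, E) 𝓘(ℝ, ℝ) ∞ (fun y => ℓ (extChartAt 𝓘(ℝ, E) x y))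
      (chartAt E x).source :=
    ℓ.contDiff.contMDiff.comp_contMDiffOn contMDiffOn_extChartAt
  refine ⟨⟨fun y => b y • ℓ (extChartAt 𝓘(ℝ, E) x y), b.contMDiff_smul hc⟩, ?_⟩
  have heq : (fun y => b y • ℓ (extChartAt 𝓘(ℝ, E) x y)) =ᶠ[nhds x]
      fun y => ℓ (extChartAt 𝓘(ℝ, E) x y) := by
    filter_upwards [b.eventuallyEq_one] with y hy
    rw [hy, Pi.one_apply, one_smul]
  have h1 : mfderiv 𝓘(ℝ, E) 𝓘(ℝ, ℝ) (fun y => b y • ℓ (extChartAt 𝓘(ℝ, E) x y)) x =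
      mfderiv 𝓘(ℝ, E) 𝓘(ℝ, ℝ) (ℓ ∘ extChartAt 𝓘(ℝ, E) x) x := heq.mfderiv_eq
  have h2 := mfderiv_comp x ℓ.mdifferentiableAt
    (mdifferentiableAt_extChartAt (I := 𝓘(ℝ, E)) (mem_chart_source E x))
  have h3 := ℓ.mfderiv_eq (x := extChartAt 𝓘(ℝ, E) x x)
  ext u
  have h4 := congrArg (fun T : E →L[ℝ] ℝ => T u) (h1.trans h2)
  rw [h3] at h4
  exact h4

/-- Vector fields are determined by their derivations of smooth functions. -/
theorem VField.ext_lieDeriv {v w : VField E M} (h : ∀ f, lieDeriv v f = lieDeriv w f) : v = w := by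
  ext x
  have hinv := isInvertible_mfderiv_extChartAt (I := 𝓘(ℝ, E)) (mem_extChartAt_source (I := 𝓘(ℝ, E)) x)
  refine hinv.injective ?_
  refine (SeparatingDual.eq_iff_forall_dual_eq (R := ℝ) (V := E)).2 fun ℓ => ?_
  obtain ⟨f, hf⟩ := exists_mvfderiv_eq x ℓ
  have h1 : mvfderiv 𝓘(ℝ, E) f x (v x) = mvfderiv 𝓘(ℝ, E) f x (w x) :=
    congrArg (fun g : SmoothFun E M => g x) (h f)
  rw [hf] at h1
  exact h1

end Separation

/-! ### The Poisson algebra of smooth functions on a symplectic manifold. -/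

section PoissonAlgebra

variable {E : Type*} [NormedAddCommGroup E] [NormedSpace ℝ E] [FiniteDimensional ℝ E]
variable {M : Type*} [TopologicalSpace M] [ChartedSpace E M] [IsManifold 𝓘(ℝ, E) ∞ M]

theorem lieDeriv_const_smul_right (c : ℝ) (v : VField E M) (f : SmoothFun E M) :
    lieDeriv v (c • f) = c • lieDeriv v f := by
  have hc : lieDeriv v (algebraMap ℝ (SmoothFun E M) c) = 0 := by
    ext x
    change mvfderiv 𝓘(ℝ, E) (fun _ : M => c) x (v x) = 0
    rw [mvfderiv_const]
    rfl
  rw [Algebra.smul_def, Algebra.smul_def, lieDeriv_mul_right, hc, mul_zero, add_zero]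

namespace SymplecticForm

variable (Ω : SymplecticForm E M)

theorem form_swap (x : M) (u v : TangentSpace 𝓘(ℝ, E) x) : Ω.form x u v = -Ω.form x v u := by
  have h := Ω.alternating x (u + v)
  rw [map_add, map_add, add_apply, add_apply, Ω.alternating, Ω.alternating] at h
  linarith

theorem isHamiltonianPair_hamField (f : SmoothFun E M) : Ω.IsHamiltonianPair (Ω.hamField f) f :=
  (Ω.isHamiltonianPair_iff _ f).2 rfl

/-- The two signs, from `dg = -ι ω` and from antisymmetry, cancel. Linearity and the Leibniz rule in
the second argument thereby reduce to those of a derivation. -/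
theorem poisson_eq_lieDeriv (f g : SmoothFun E M) :
    Ω.poisson f g = lieDeriv (Ω.hamField f) g := by
  ext x
  change Ω.form x (Ω.hamField f x) (Ω.hamField g x) =
    mvfderiv 𝓘(ℝ, E) g x (Ω.hamField f x)
  rw [Ω.isHamiltonianPair_hamField g x, form_swap]

theorem poisson_swap (f g : SmoothFun E M) : Ω.poisson f g = -Ω.poisson g f := by
  ext x
  exact Ω.form_swap x _ _

theorem poisson_self (f : SmoothFun E M) : Ω.poisson f f = 0 := by
  ext x
  exact Ω.alternating x _

theorem poisson_add_right (f g h : SmoothFun E M) :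
    Ω.poisson f (g + h) = Ω.poisson f g + Ω.poisson f h := by
  simp only [poisson_eq_lieDeriv, lieDeriv_add_right]

theorem poisson_smul_right (c : ℝ) (f g : SmoothFun E M) :
    Ω.poisson f (c • g) = c • Ω.poisson f g := by
  simp only [poisson_eq_lieDeriv, lieDeriv_const_smul_right]

theorem poisson_mul_right (f g h : SmoothFun E M) :
    Ω.poisson f (g * h) = Ω.poisson f g * h + g * Ω.poisson f h := by
  simp only [poisson_eq_lieDeriv, lieDeriv_mul_right]
  ring

/-- Pairing with `v_h` is differentiation of `h`, and the bracket acts as a commutator. This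
rewrites the Lie bracket terms of `closed` as iterated Poisson brackets. -/
theorem form_lieBracket_hamField (f g h : SmoothFun E M) (x : M) :
    Ω.form x (lieBracket (Ω.hamField f) (Ω.hamField g) x) (Ω.hamField h x) =
      Ω.poisson f (Ω.poisson g h) x - Ω.poisson g (Ω.poisson f h) x := by
  have h1 := Ω.isHamiltonianPair_hamField h x (lieBracket (Ω.hamField f) (Ω.hamField g) x)
  rw [form_swap, ← h1, ← lieDeriv_apply, lieDeriv_lieBracket]
  simp only [poisson_eq_lieDeriv]
  rfl

/-- In `closed` on three Hamiltonian fields, the derivative terms add up to the Jacobi sum and the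
Lie bracket terms to minus twice that sum, so the sum vanishes. -/
theorem poisson_jacobi (f g h : SmoothFun E M) :
    Ω.poisson f (Ω.poisson g h) + Ω.poisson g (Ω.poisson h f) +
      Ω.poisson h (Ω.poisson f g) = 0 := by
  ext x
  have hc := Ω.closed (Ω.hamField f) (Ω.hamField g) (Ω.hamField h) x
  rw [form_lieBracket_hamField, form_lieBracket_hamField, form_lieBracket_hamField] at hc
  have e1 : mvfderiv 𝓘(ℝ, E) (fun y => Ω.form y (Ω.hamField g y) (Ω.hamField h y)) x
      (Ω.hamField f x) = Ω.poisson f (Ω.poisson g h) x := by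
    rw [Ω.poisson_eq_lieDeriv f]; rfl
  have e2 : mvfderiv 𝓘(ℝ, E) (fun y => Ω.form y (Ω.hamField f y) (Ω.hamField h y)) x
      (Ω.hamField g x) = Ω.poisson g (Ω.poisson f h) x := by
    rw [Ω.poisson_eq_lieDeriv g]; rfl
  have e3 : mvfderiv 𝓘(ℝ, E) (fun y => Ω.form y (Ω.hamField f y) (Ω.hamField g y)) x
      (Ω.hamField h x) = Ω.poisson h (Ω.poisson f g) x := by
    rw [Ω.poisson_eq_lieDeriv h]; rfl
  have neg_right (a b : SmoothFun E M) : Ω.poisson a (-b) = -Ω.poisson a b := by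
    rw [← neg_one_smul ℝ b, poisson_smul_right, neg_one_smul]
  have s1 : Ω.poisson g (Ω.poisson f h) x = -Ω.poisson g (Ω.poisson h f) x := by
    rw [Ω.poisson_swap f h, neg_right]; rfl
  have s2 : Ω.poisson f (Ω.poisson h g) x = -Ω.poisson f (Ω.poisson g h) x := by
    rw [Ω.poisson_swap h g, neg_right]; rfl
  have s3 : Ω.poisson h (Ω.poisson g f) x = -Ω.poisson h (Ω.poisson f g) x := by
    rw [Ω.poisson_swap g f, neg_right]; rfl
  rw [e1, e2, e3] at hc
  simp only [s1, s2, s3] at hc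
  change Ω.poisson f (Ω.poisson g h) x + Ω.poisson g (Ω.poisson h f) x +
    Ω.poisson h (Ω.poisson f g) x = 0
  linarith

/-- The Poisson algebra of smooth functions. -/
def poissonBracket : PoissonBracket (SmoothFun E M) where
  bracket := LinearMap.mk₂ ℝ Ω.poisson
    (fun f g h => by
      rw [Ω.poisson_swap, poisson_add_right, neg_add, ← Ω.poisson_swap, ← Ω.poisson_swap])
    (fun c f g => by rw [Ω.poisson_swap, poisson_smul_right, ← smul_neg, ← Ω.poisson_swap])
    Ω.poisson_add_right (fun c f g => Ω.poisson_smul_right c f g)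
  self := Ω.poisson_self
  jacobi := Ω.poisson_jacobi
  leibniz := Ω.poisson_mul_right

theorem poisson_neg_right (f g : SmoothFun E M) : Ω.poisson f (-g) = -Ω.poisson f g :=
  map_neg (Ω.poissonBracket.bracket f) g

theorem poisson_poisson_left (f g h : SmoothFun E M) :
    Ω.poisson (Ω.poisson f g) h =
      Ω.poisson f (Ω.poisson g h) - Ω.poisson g (Ω.poisson f h) := by
  have hj := Ω.poisson_jacobi f g h
  rw [Ω.poisson_swap h f, poisson_neg_right, Ω.poisson_swap h] at hj
  linear_combination -hj

/-- The map from functions to Hamiltonian vector fields is a Lie algebra morphism. -/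
theorem hamField_poisson [T2Space M] (f g : SmoothFun E M) :
    Ω.hamField (Ω.poisson f g) = lieBracket (Ω.hamField f) (Ω.hamField g) := by
  -- Compared as derivations, the two fields agree by the Jacobi identity in commutator form.
  refine VField.ext_lieDeriv fun h => ?_
  rw [lieDeriv_lieBracket]
  simp only [← poisson_eq_lieDeriv]
  exact Ω.poisson_poisson_left f g h

theorem hamField_add (f g : SmoothFun E M) :
    Ω.hamField (f + g) = Ω.hamField f + Ω.hamField g :=
  ((Ω.isHamiltonianPair_iff _ _).1
    ((Ω.isHamiltonianPair_hamField f).add (Ω.isHamiltonianPair_hamField g))).symm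

theorem hamField_mul (f g : SmoothFun E M) :
    Ω.hamField (f * g) = f • Ω.hamField g + g • Ω.hamField f :=
  ((Ω.isHamiltonianPair_iff _ _).1
    ((Ω.isHamiltonianPair_hamField f).mul (Ω.isHamiltonianPair_hamField g))).symm

theorem hamField_zero : Ω.hamField (0 : SmoothFun E M) = 0 := by
  have h := (Ω.isHamiltonianPair_iff _ _).1 (Ω.isHamiltonianPair_const 0)
  rw [map_zero] at h
  exact h.symm

end SymplecticForm

end PoissonAlgebra

/-! ### Restriction to subalgebras and passage to quotients. -/

namespace PoissonBracket

variable {A : Type*} [CommRing A] [Algebra ℝ A]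

/-- The restriction of a Poisson bracket to a subalgebra closed under the bracket. -/
def restrict (B : PoissonBracket A) (S : Subalgebra ℝ A)
    (hS : ∀ a ∈ S, ∀ b ∈ S, B.bracket a b ∈ S) : PoissonBracket S where
  bracket := LinearMap.mk₂ ℝ (fun a b => ⟨B.bracket a b, hS a a.2 b b.2⟩)
    (fun a b c => Subtype.ext (by simp)) (fun r a b => Subtype.ext (by simp))
    (fun a b c => Subtype.ext (by simp)) (fun r a b => Subtype.ext (by simp))
  self a := Subtype.ext (B.self a)
  jacobi a b c := Subtype.ext (B.jacobi a b c)
  leibniz a b c := Subtype.ext (B.leibniz a b c)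

theorem swap (B : PoissonBracket A) (a b : A) : B.bracket a b = -B.bracket b a := by
  have h := B.self (a + b)
  simp only [map_add, LinearMap.add_apply, B.self, zero_add, add_zero] at h
  exact eq_neg_of_add_eq_zero_right h

/-- The difference of the brackets is `{a, b - b'} + {a - a', b'}`. Since `hI` controls only the
second argument, the last term is first turned round by antisymmetry. -/
theorem mk_bracket_congr (B : PoissonBracket A) {I : Ideal A}
    (hI : ∀ a, ∀ i ∈ I, B.bracket a i ∈ I) {a a' b b' : A}
    (ha : Ideal.Quotient.mk I a = Ideal.Quotient.mk I a')
    (hb : Ideal.Quotient.mk I b = Ideal.Quotient.mk I b') :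
    Ideal.Quotient.mk I (B.bracket a b) = Ideal.Quotient.mk I (B.bracket a' b') := by
  rw [Ideal.Quotient.eq] at ha hb ⊢
  have h1 := hI a _ hb
  have h2 := neg_mem (hI b' _ ha)
  rw [← B.swap, map_sub, LinearMap.sub_apply] at h2
  rw [map_sub] at h1
  simpa using add_mem h1 h2

/-- The Poisson bracket induced on the quotient by a Poisson ideal. -/
def quotient (B : PoissonBracket A) (I : Ideal A)
    (hI : ∀ a, ∀ i ∈ I, B.bracket a i ∈ I) : PoissonBracket (A ⧸ I) :=
  let m := Ideal.Quotient.mk I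
  -- The bracket uses chosen representatives; `hbr` shows that the choice is immaterial, and all
  -- axioms then descend along the surjection `m`.
  let br : A ⧸ I → A ⧸ I → A ⧸ I := fun a b => m (B.bracket a.out b.out)
  have hbr (a b : A) : br (m a) (m b) = m (B.bracket a b) :=
    B.mk_bracket_congr hI (Ideal.Quotient.mk_out _) (Ideal.Quotient.mk_out _)
  have hm : Function.Surjective m := Ideal.Quotient.mk_surjective
  have hsmul (r : ℝ) (a : A) : r • m a = m (r • a) := rfl
  { bracket := LinearMap.mk₂ ℝ br
      (hm.forall.2 fun a => hm.forall.2 fun b => hm.forall.2 fun c => by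
        rw [← map_add m, hbr, hbr, hbr, ← map_add m, map_add B.bracket, LinearMap.add_apply])
      (fun r => hm.forall.2 fun a => hm.forall.2 fun b => by
        rw [hsmul, hbr, hbr, hsmul, map_smul, LinearMap.smul_apply])
      (hm.forall.2 fun a => hm.forall.2 fun b => hm.forall.2 fun c => by
        rw [← map_add m, hbr, hbr, hbr, ← map_add m, map_add])
      (fun r => hm.forall.2 fun a => hm.forall.2 fun b => by
        rw [hsmul, hbr, hbr, hsmul, map_smul])
    self := hm.forall.2 fun a => by
      rw [LinearMap.mk₂_apply, hbr, B.self, map_zero]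
    jacobi := hm.forall.2 fun a => hm.forall.2 fun b => hm.forall.2 fun c => by
      simp only [LinearMap.mk₂_apply, hbr]
      rw [← map_add m, ← map_add m, B.jacobi, map_zero]
    leibniz := hm.forall.2 fun a => hm.forall.2 fun b => hm.forall.2 fun c => by
      simp only [LinearMap.mk₂_apply, hbr, ← map_mul, ← map_add]
      rw [B.leibniz] }

theorem quotient_bracket_mk (B : PoissonBracket A) (I : Ideal A)
    (hI : ∀ a, ∀ i ∈ I, B.bracket a i ∈ I) (a b : A) :
    (B.quotient I hI).bracket (Ideal.Quotient.mk I a) (Ideal.Quotient.mk I b) =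
      Ideal.Quotient.mk I (B.bracket a b) :=
  B.mk_bracket_congr hI (Ideal.Quotient.mk_out _) (Ideal.Quotient.mk_out _)

end PoissonBracket

/-! ### Invariant functions and their Hamiltonian fields. -/

section Invariants

variable {E : Type*} [NormedAddCommGroup E] [NormedSpace ℝ E] [FiniteDimensional ℝ E]
variable {M : Type*} [TopologicalSpace M] [ChartedSpace E M] [IsManifold 𝓘(ℝ, E) ∞ M]
variable {F : Type*} [NormedAddCommGroup F] [NormedSpace ℝ F]
variable {G : Type*} [TopologicalSpace G] [ChartedSpace F G] [Group G] [LieGroup 𝓘(ℝ, F) ∞ G]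
variable [MulAction G M] {Ω : SymplecticForm E M}

/-! ### Invariant functions -/

variable (F) in
theorem mdifferentiableAt_smul [ContMDiffSMul 𝓘(ℝ, F) 𝓘(ℝ, E) ∞ G M]
    (g : G) (x : M) :
    MDifferentiableAt 𝓘(ℝ, E) 𝓘(ℝ, E) (fun y : M => g • y) x := by
  have h : ContMDiff 𝓘(ℝ, E) 𝓘(ℝ, E) ∞ (fun y : M => g • y) :=
    (contMDiff_smul (I := 𝓘(ℝ, F)) (I' := 𝓘(ℝ, E)) (n := ∞) (G := G) (M := M)).comp
      (contMDiff_const.prodMk contMDiff_id)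
  exact h.mdifferentiableAt (by simp)

theorem mdifferentiableAt_smul_left [ContMDiffSMul 𝓘(ℝ, F) 𝓘(ℝ, E) ∞ G M]
    (g : G) (x : M) :
    MDifferentiableAt 𝓘(ℝ, F) 𝓘(ℝ, E) (fun h : G => h • x) g := by
  have h : ContMDiff 𝓘(ℝ, F) 𝓘(ℝ, E) ∞ (fun h : G => h • x) :=
    (contMDiff_smul (I := 𝓘(ℝ, F)) (I' := 𝓘(ℝ, E)) (n := ∞) (G := G) (M := M)).comp
      (contMDiff_id.prodMk contMDiff_const)
  exact h.mdifferentiableAt (by simp)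

/-- Invariant functions are constant along the fundamental vector fields. -/
theorem lieDeriv_fundamentalField_of_invariant [ContMDiffSMul 𝓘(ℝ, F) 𝓘(ℝ, E) ∞ G M]
    {f : SmoothFun E M} (hf : f ∈ invariants E M G)
    (ξ : GroupLieAlgebra 𝓘(ℝ, F) G) : lieDeriv (fundamentalField ξ) f = 0 := by
  ext x
  -- Along the orbit map of `x` the function is constant; the chain rule at `1` does the rest.
  have h1 : mvfderiv 𝓘(ℝ, F) (f ∘ fun g : G => g • x) 1 = 0 := by
    have : (f ∘ fun g : G => g • x) = fun _ => f x := funext fun g => hf g x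
    rw [this, mvfderiv_const]
  rw [mvfderiv_comp_of_eq (f.mdifferentiableAt (x := x)) (mdifferentiableAt_smul_left 1 x)
    (one_smul G x)] at h1
  have h2 : mvfderiv 𝓘(ℝ, E) f x (mfderiv 𝓘(ℝ, F) 𝓘(ℝ, E) (fun g : G => g • x) 1 ξ) = 0 := by
    have h3 := congrArg (fun T => T ξ) h1
    rw [one_smul G x] at h3
    exact h3
  change mvfderiv 𝓘(ℝ, E) f x
    (-(mfderiv 𝓘(ℝ, F) 𝓘(ℝ, E) (fun g : G => g • x) 1 ξ : TangentSpace 𝓘(ℝ, E) x)) = 0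
  exact (map_neg (mvfderiv 𝓘(ℝ, E) f x) _).trans (neg_eq_zero.2 h2)

-- The derivative of the action of `g⁻¹` is a right inverse. Hence nondegeneracy at `g • x` can be
-- tested on pushed-forward vectors alone.
variable (F) in
theorem mfderiv_smul_surjective [ContMDiffSMul 𝓘(ℝ, F) 𝓘(ℝ, E) ∞ G M]
    (g : G) (x : M) :
    Function.Surjective (mfderiv 𝓘(ℝ, E) 𝓘(ℝ, E) (fun y : M => g • y) x) := by
  have h1 := mfderiv_comp_of_eq (I := 𝓘(ℝ, E)) (I' := 𝓘(ℝ, E)) (I'' := 𝓘(ℝ, E)) (x := g • x)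
    (g := fun y : M => g • y) (f := fun y : M => g⁻¹ • y) (y := x)
    (mdifferentiableAt_smul F g x) (mdifferentiableAt_smul F g⁻¹ (g • x)) (inv_smul_smul g x)
  have h2 : ((fun y : M => g • y) ∘ fun y : M => g⁻¹ • y) = id :=
    funext fun y => smul_inv_smul g y
  rw [h2, mfderiv_id, inv_smul_smul] at h1
  intro u
  exact ⟨mfderiv 𝓘(ℝ, E) 𝓘(ℝ, E) (fun y : M => g⁻¹ • y) (g • x) u,
    (congrArg (fun T : E →L[ℝ] E => T u) h1).symm⟩

variable (F) in
/-- The Hamiltonian vector field of an invariant function is invariant. -/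
theorem mfderiv_smul_hamField [ContMDiffSMul 𝓘(ℝ, F) 𝓘(ℝ, E) ∞ G M]
    (hΩ : Ω.IsSymplecticAction G) {f : SmoothFun E M}
    (hf : f ∈ invariants E M G) (g : G) (x : M) :
    mfderiv 𝓘(ℝ, E) 𝓘(ℝ, E) (fun y : M => g • y) x (Ω.hamField f x) =
      Ω.hamField f (g • x) := by
  rw [← sub_eq_zero]
  refine Ω.nondegenerate (g • x) _ fun u => ?_
  obtain ⟨u, rfl⟩ := mfderiv_smul_surjective F g x u
  rw [map_sub, sub_apply, sub_eq_zero]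
  have h1 : mvfderiv 𝓘(ℝ, E) (f ∘ fun y : M => g • y) x = mvfderiv 𝓘(ℝ, E) f x :=
    -- Differentiating `f (g • y) = f y` shows that both fields pair equally with pushed-forward
    -- vectors, once the form is known to be invariant.
    congrArg (fun k : M → ℝ => mvfderiv 𝓘(ℝ, E) k x) (funext fun y => hf g y)
  rw [mvfderiv_comp x (f.mdifferentiableAt (x := g • x)) (mdifferentiableAt_smul F g x)] at h1
  have h2 : mvfderiv 𝓘(ℝ, E) f (g • x)
      (mfderiv 𝓘(ℝ, E) 𝓘(ℝ, E) (fun y : M => g • y) x u) = mvfderiv 𝓘(ℝ, E) f x u :=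
    congrArg (fun T : E →L[ℝ] ℝ => T u) h1
  rw [Ω.isHamiltonianPair_hamField f, Ω.isHamiltonianPair_hamField f] at h2
  refine Eq.trans (hΩ g x (Ω.hamField f x) u) ?_
  exact (neg_injective h2).symm

variable (F) in
theorem poisson_mem_invariants [ContMDiffSMul 𝓘(ℝ, F) 𝓘(ℝ, E) ∞ G M]
    (hΩ : Ω.IsSymplecticAction G) {f h : SmoothFun E M}
    (hf : f ∈ invariants E M G) (hh : h ∈ invariants E M G) :
    Ω.poisson f h ∈ invariants E M G := by
  intro g x
  have key := hΩ g x (Ω.hamField f x) (Ω.hamField h x)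
  rw [mfderiv_smul_hamField F hΩ hf, mfderiv_smul_hamField F hΩ hh] at key
  exact key

end Invariants

/-! ### The two reductions and their comparison. -/

section Reduction

variable {E : Type*} [NormedAddCommGroup E] [NormedSpace ℝ E] [FiniteDimensional ℝ E]
variable {M : Type*} [TopologicalSpace M] [ChartedSpace E M] [IsManifold 𝓘(ℝ, E) ∞ M]
variable {F : Type*} [NormedAddCommGroup F] [NormedSpace ℝ F]
variable {G : Type*} [TopologicalSpace G] [ChartedSpace F G] [Group G] [LieGroup 𝓘(ℝ, F) ∞ G]
variable [MulAction G M] [ContMDiffSMul 𝓘(ℝ, F) 𝓘(ℝ, E) ∞ G M]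
variable {Ω : SymplecticForm E M} {N : Set M}

/-! ### The momentum ideal -/

namespace MomentMap

variable (μ : MomentMap Ω F G)

theorem hamField_component (ξ : GroupLieAlgebra 𝓘(ℝ, F) G) :
    Ω.hamField (component μ.toMap ξ) = fundamentalField ξ :=
  ((Ω.isHamiltonianPair_iff _ _).1 (μ.hamiltonian ξ)).symm

theorem poisson_component_left (ξ : GroupLieAlgebra 𝓘(ℝ, F) G) (f : SmoothFun E M) :
    Ω.poisson (component μ.toMap ξ) f = lieDeriv (fundamentalField ξ) f := by
  rw [Ω.poisson_eq_lieDeriv, hamField_component]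

/-- Noether's theorem: the momenta are conserved along the flow of an invariant Hamiltonian. -/
theorem poisson_component_of_invariant {f : SmoothFun E M} (hf : f ∈ invariants E M G)
    (ξ : GroupLieAlgebra 𝓘(ℝ, F) G) : Ω.poisson f (component μ.toMap ξ) = 0 := by
  rw [Ω.poisson_swap, poisson_component_left, lieDeriv_fundamentalField_of_invariant hf, neg_zero]

/-- A derivation that kills the generators of an ideal preserves the ideal. -/
theorem poisson_mem_momentumIdeal_of_invariant {f : SmoothFun E M} (hf : f ∈ invariants E M G)
    {h : SmoothFun E M} (hh : h ∈ μ.momentumIdeal) : Ω.poisson f h ∈ μ.momentumIdeal := by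
  refine Submodule.span_induction (p := fun h _ => Ω.poisson f h ∈ μ.momentumIdeal)
    ?_ ?_ ?_ ?_ hh
  · rintro _ ⟨ξ, rfl⟩
    change Ω.poisson f (component μ.toMap ξ) ∈ _
    rw [μ.poisson_component_of_invariant hf]
    exact zero_mem _
  · change Ω.poissonBracket.bracket f 0 ∈ _
    rw [map_zero]
    exact zero_mem _
  · intro a b _ _ ha hb
    rw [Ω.poisson_add_right]
    exact add_mem ha hb
  · intro a b hb' hb
    rw [smul_eq_mul, Ω.poisson_mul_right]
    exact add_mem (Ideal.mul_mem_left _ _ hb') (Ideal.mul_mem_left _ _ hb)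

/-- Along a set on which the moment map vanishes, the Hamiltonian vector field of a function in the
momentum ideal agrees with a combination of fundamental vector fields. -/
theorem hamField_mem_of_mem_momentumIdeal (hI : μ.momentumIdeal ≤ vanishingIdeal E N)
    {f : SmoothFun E M} (hf : f ∈ μ.momentumIdeal) :
    Ω.hamField f ∈ fundamentalModule E M F G ⊔ vanishingFields E N := by
  refine Submodule.span_induction
    (p := fun f _ => Ω.hamField f ∈ fundamentalModule E M F G ⊔ vanishingFields E N)
    ?_ ?_ ?_ ?_ hf
  · rintro _ ⟨ξ, rfl⟩
    change Ω.hamField (component μ.toMap ξ) ∈ _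
    rw [hamField_component]
    exact Submodule.mem_sup_left (Submodule.subset_span ⟨ξ, rfl⟩)
  · rw [Ω.hamField_zero]
    exact zero_mem _
  · intro a b _ _ ha hb
    rw [Ω.hamField_add]
    exact add_mem ha hb
  · intro a b hb' hb
    -- In `a • v_b + b • v_a` the second term vanishes on `N`, because `b` lies in the momentum
    -- ideal.
    rw [smul_eq_mul, Ω.hamField_mul]
    exact add_mem (Submodule.smul_mem _ _ hb)
      (Submodule.mem_sup_right (smul_mem_vanishingFields (hI hb') _))

end MomentMap

/-! ### Reducible observables -/

/-- Reducible fields preserve the fields that represent zero in the reduction. -/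
theorem IsReducibleField.lieBracket_mem {v w : VField E M} (hv : IsReducibleField F G N v)
    (hw : w ∈ fundamentalModule E M F G ⊔ vanishingFields E N) :
    lieBracket v w ∈ fundamentalModule E M F G ⊔ vanishingFields E N := by
  obtain ⟨a, ha, b, hb, rfl⟩ := Submodule.mem_sup.1 hw
  rw [lieBracket_add_right]
  refine add_mem ?_ (Submodule.mem_sup_right fun f => ?_)
  · refine Submodule.span_induction
      (p := fun a _ => lieBracket v a ∈ fundamentalModule E M F G ⊔ vanishingFields E N)
      ?_ ?_ ?_ ?_ ha
    · rintro _ ⟨ξ, rfl⟩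
      exact hv.2 ξ
    · rw [lieBracket_swap, lieBracket_zero_left, neg_zero]
      exact zero_mem _
    · intro x y _ _ hx hy
      rw [lieBracket_add_right]
      exact add_mem hx hy
    · intro f x hx' hx
      rw [lieBracket_smul_right]
      exact add_mem (Submodule.mem_sup_left (Submodule.smul_mem _ _ hx'))
        (Submodule.smul_mem _ _ hx)
  -- For `b` vanishing on `N`, in `v (b f) - b (v f)` the first term is in `I_N` by tangency of `v`,
  -- the second by the vanishing of `b`.
  · rw [lieDeriv_lieBracket]
    exact sub_mem (hv.1 _ (hb f)) (hb _)

/-- By Jacobi, `[[v, w], ξ] = [v, [w, ξ]] - [w, [v, ξ]]`; the inner brackets lie in the module that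
reducible fields preserve. -/
theorem IsReducibleField.lieBracket {v w : VField E M} (hv : IsReducibleField F G N v)
    (hw : IsReducibleField F G N w) : IsReducibleField F G N (lieBracket v w) := by
  refine ⟨fun h hh => ?_, fun ξ => ?_⟩
  · rw [lieDeriv_lieBracket]
    exact sub_mem (hv.1 _ (hw.1 _ hh)) (hw.1 _ (hv.1 _ hh))
  · have h := lieBracket_lieBracket v w (fundamentalField ξ)
    rw [← sub_eq_iff_eq_add] at h
    rw [← h]
    exact sub_mem (hv.lieBracket_mem (hw.2 ξ)) (hw.lieBracket_mem (hv.2 ξ))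

/-- Hamiltonian fields are unique, which removes the existential quantifier. -/
theorem mem_reducibleObservables {f : SmoothFun E M} : f ∈ reducibleObservables Ω F G N ↔
    IsReducibleField F G N (Ω.hamField f) ∧ IsReducibleFun F G N f := by
  constructor
  · rintro ⟨v, h1, h2⟩
    rwa [(Ω.isHamiltonianPair_iff v f).1 h1] at h2
  · exact fun h => ⟨_, Ω.isHamiltonianPair_hamField f, h⟩

theorem mem_vanishingObservables {f : reducibleObservables Ω F G N} :
    f ∈ vanishingObservables Ω F G N ↔
      Ω.hamField f ∈ fundamentalModule E M F G ⊔ vanishingFields E N ∧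
        (f : SmoothFun E M) ∈ vanishingIdeal E N := by
  constructor
  · rintro ⟨v, h1, -, -, h4, h5⟩
    rw [(Ω.isHamiltonianPair_iff v f).1 h1] at h4
    exact ⟨h4, h5⟩
  · intro h
    have hf := mem_reducibleObservables.1 f.2
    exact ⟨_, Ω.isHamiltonianPair_hamField f, hf.1, hf.2, h.1, h.2⟩

/-- The moment map serves to write `ξ` as `{μ_ξ, ·}`. Jacobi then gives `ξ{f, g} = {f, ξ g} - {g, ξ
f}`, and both terms are in `I_N` since `v_f` and `v_g` are tangent to `N`. -/
theorem poisson_mem_reducibleObservables [T2Space M] (μ : MomentMap Ω F G) {f g : SmoothFun E M}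
    (hf : f ∈ reducibleObservables Ω F G N) (hg : g ∈ reducibleObservables Ω F G N) :
    Ω.poisson f g ∈ reducibleObservables Ω F G N := by
  rw [mem_reducibleObservables] at hf hg ⊢
  rw [Ω.hamField_poisson]
  refine ⟨hf.1.lieBracket hg.1, fun ξ => ?_⟩
  have h1 : Ω.poisson g (lieDeriv (fundamentalField ξ) f) ∈ vanishingIdeal E N := by
    rw [Ω.poisson_eq_lieDeriv]
    exact hg.1.1 _ (hf.2 ξ)
  have h2 : Ω.poisson f (lieDeriv (fundamentalField ξ) g) ∈ vanishingIdeal E N := by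
    rw [Ω.poisson_eq_lieDeriv]
    exact hf.1.1 _ (hg.2 ξ)
  simp only [← μ.poisson_component_left] at h1 h2 ⊢
  have h3 := Ω.poisson_jacobi (component μ.toMap ξ) f g
  rw [Ω.poisson_swap g (component μ.toMap ξ), Ω.poisson_neg_right, add_assoc,
    ← eq_neg_iff_add_eq_zero] at h3
  rw [h3]
  exact neg_mem (add_mem (neg_mem h2) h1)

theorem poisson_mem_vanishingObservables [T2Space M]
    {f g : SmoothFun E M} (hf : f ∈ reducibleObservables Ω F G N)
    (hg : Ω.hamField g ∈ fundamentalModule E M F G ⊔ vanishingFields E N ∧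
      g ∈ vanishingIdeal E N) :
    Ω.hamField (Ω.poisson f g) ∈ fundamentalModule E M F G ⊔ vanishingFields E N ∧
      Ω.poisson f g ∈ vanishingIdeal E N := by
  have hf' := mem_reducibleObservables.1 hf
  rw [Ω.hamField_poisson]
  refine ⟨hf'.1.lieBracket_mem hg.1, ?_⟩
  rw [Ω.poisson_eq_lieDeriv]
  exact hf'.1.1 _ hg.2

/-- Only tangency of `v_f` to `N` needs `hI`: it is known for the momentum ideal. The bracket with
`ξ` is the Hamiltonian field of `{f, μ_ξ} = 0`. -/
theorem invariants_le_reducibleObservables [T2Space M] (μ : MomentMap Ω F G)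
    (hI : μ.momentumIdeal = vanishingIdeal E N) :
    invariants E M G ≤ reducibleObservables Ω F G N := by
  intro f hf
  refine mem_reducibleObservables.2 ⟨⟨fun h hh => ?_, fun ξ => ?_⟩, fun ξ => ?_⟩
  · rw [← hI] at hh ⊢
    rw [← Ω.poisson_eq_lieDeriv]
    exact μ.poisson_mem_momentumIdeal_of_invariant hf hh
  · rw [← μ.hamField_component, ← Ω.hamField_poisson, μ.poisson_component_of_invariant hf,
      Ω.hamField_zero]
    exact zero_mem _
  · rw [lieDeriv_fundamentalField_of_invariant hf]
    exact zero_mem _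

theorem reducibleObservables_subset_firstClass :
    (reducibleObservables Ω F G N : Set (SmoothFun E M)) ⊆ Ω.firstClass N := by
  intro f hf h hh
  rw [Ω.poisson_eq_lieDeriv]
  exact (mem_reducibleObservables.1 hf).1.1 h hh

/-- If the momentum ideal is the vanishing ideal, the vanishing observables are exactly the
reducible observables that vanish on `N`. -/
theorem mem_vanishingObservables_iff_mem_vanishingIdeal (μ : MomentMap Ω F G)
    (hI : μ.momentumIdeal = vanishingIdeal E N) {f : reducibleObservables Ω F G N} :
    f ∈ vanishingObservables Ω F G N ↔ (f : SmoothFun E M) ∈ vanishingIdeal E N :=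
  ⟨fun h => (mem_vanishingObservables.1 h).2, fun h => mem_vanishingObservables.2
    ⟨μ.hamField_mem_of_mem_momentumIdeal hI.le (hI ▸ h), h⟩⟩

/-- The Poisson bracket of the Arms-Cushman-Gotay reduction. -/
def acgPoissonBracket (hΩ : Ω.IsSymplecticAction G) (μ : MomentMap Ω F G)
    (hI : μ.momentumIdeal = vanishingIdeal E N) : PoissonBracket (ACGReduction E G N) :=
  (Ω.poissonBracket.restrict (invariants E M G)
    fun _ ha _ hb => poisson_mem_invariants F hΩ ha hb).quotient (invariantVanishingIdeal E G N)
    fun a i hi => by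
      -- An invariant function is known to preserve `I_μ`, so the passage to `I_N` goes through `hI`
      -- in both directions.
      have hi' : (i : SmoothFun E M) ∈ μ.momentumIdeal := hI ▸ hi
      have h := μ.poisson_mem_momentumIdeal_of_invariant a.2 hi'
      rw [hI] at h
      exact h

/-- The Poisson bracket of the `L_∞`-reduction. -/
def lInftyPoissonBracket [T2Space M] (N : Set M) (μ : MomentMap Ω F G) :
    PoissonBracket (LInftyReduction Ω F G N) :=
  (Ω.poissonBracket.restrict (reducibleObservables Ω F G N)
    fun _ ha _ hb => poisson_mem_reducibleObservables μ ha hb).quotient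
    (vanishingObservables Ω F G N)
    fun a _ hi => mem_vanishingObservables.2
      (poisson_mem_vanishingObservables a.2 (mem_vanishingObservables.1 hi))

theorem acgPoissonBracket_mk (hΩ : Ω.IsSymplecticAction G) (μ : MomentMap Ω F G)
    (hI : μ.momentumIdeal = vanishingIdeal E N) (f g : invariants E M G) :
    (acgPoissonBracket hΩ μ hI).bracket (Ideal.Quotient.mk _ f) (Ideal.Quotient.mk _ g) =
      Ideal.Quotient.mk _ ⟨Ω.poisson f g, poisson_mem_invariants F hΩ f.2 g.2⟩ :=
  PoissonBracket.quotient_bracket_mk _ _ _ f g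

theorem lInftyPoissonBracket_mk [T2Space M] (μ : MomentMap Ω F G)
    (f g : reducibleObservables Ω F G N) :
    (lInftyPoissonBracket N μ).bracket (Ideal.Quotient.mk _ f) (Ideal.Quotient.mk _ g) =
      Ideal.Quotient.mk _ ⟨Ω.poisson f g, poisson_mem_reducibleObservables μ f.2 g.2⟩ :=
  PoissonBracket.quotient_bracket_mk _ _ _ f g

/-- The comparison map from the Arms-Cushman-Gotay reduction to the `L_∞`-reduction. -/
def acgToLInfty [T2Space M] (μ : MomentMap Ω F G) (hI : μ.momentumIdeal = vanishingIdeal E N) :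
    ACGReduction E G N →ₐ[ℝ] LInftyReduction Ω F G N :=
  Ideal.quotientMapₐ (vanishingObservables Ω F G N)
    (Subalgebra.inclusion (invariants_le_reducibleObservables μ hI))
    fun _ hf => (mem_vanishingObservables_iff_mem_vanishingIdeal μ hI).2 hf

theorem acgToLInfty_mk [T2Space M] (μ : MomentMap Ω F G)
    (hI : μ.momentumIdeal = vanishingIdeal E N) (f : invariants E M G) :
    acgToLInfty μ hI (Ideal.Quotient.mk _ f) =
      Ideal.Quotient.mk _ (Subalgebra.inclusion (invariants_le_reducibleObservables μ hI) f) :=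
  rfl

theorem acgToLInfty_bracket [T2Space M] (hΩ : Ω.IsSymplecticAction G) (μ : MomentMap Ω F G)
    (hI : μ.momentumIdeal = vanishingIdeal E N) (a b : ACGReduction E G N) :
    acgToLInfty μ hI ((acgPoissonBracket hΩ μ hI).bracket a b) =
      (lInftyPoissonBracket N μ).bracket (acgToLInfty μ hI a) (acgToLInfty μ hI b) := by
  obtain ⟨f, rfl⟩ := Ideal.Quotient.mk_surjective a
  obtain ⟨g, rfl⟩ := Ideal.Quotient.mk_surjective b
  rw [acgPoissonBracket_mk]
  simp only [acgToLInfty_mk]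
  rw [lInftyPoissonBracket_mk]
  rfl

/-- Vanishing observables vanish on `N` by definition, so an invariant one already lies in `I_N^G`.
-/
theorem acgToLInfty_injective [T2Space M] (μ : MomentMap Ω F G)
    (hI : μ.momentumIdeal = vanishingIdeal E N) : Function.Injective (acgToLInfty μ hI) := by
  refine (injective_iff_map_eq_zero _).2 (Ideal.Quotient.mk_surjective.forall.2 fun f hf => ?_)
  rw [acgToLInfty_mk, Ideal.Quotient.eq_zero_iff_mem] at hf
  exact Ideal.Quotient.eq_zero_iff_mem.2 (mem_vanishingObservables.1 hf).2

/-- Write a reducible `f`, being first class, as `a + b` with `a` invariant and `b` in `I_N`. As `a`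
is reducible, so is `b = f - a`; vanishing on `N`, it represents zero, so `a` and `f` have the same
class. -/
theorem acgToLInfty_surjective [T2Space M] (μ : MomentMap Ω F G)
    (hI : μ.momentumIdeal = vanishingIdeal E N)
    (hF : Ω.firstClass N = (invariants E M G : Set (SmoothFun E M)) +
      (vanishingIdeal E N : Set (SmoothFun E M))) :
    Function.Surjective (acgToLInfty μ hI) := by
  refine Ideal.Quotient.mk_surjective.forall.2 fun f => ?_
  have hf : (f : SmoothFun E M) ∈ Ω.firstClass N := reducibleObservables_subset_firstClass f.2
  rw [hF] at hf
  obtain ⟨a, ha, b, hb, hab⟩ := Set.mem_add.1 hf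
  refine ⟨Ideal.Quotient.mk _ ⟨a, ha⟩, ?_⟩
  rw [acgToLInfty_mk, eq_comm, Ideal.Quotient.eq,
    mem_vanishingObservables_iff_mem_vanishingIdeal μ hI]
  have h : (f : SmoothFun E M) - a = b := by rw [← hab, add_sub_cancel_left]
  change (f : SmoothFun E M) - a ∈ _
  rw [h]
  exact hb

end Reduction

end SymplecticReduction

end

theorem mainTheorem8
    {E : Type*} [NormedAddCommGroup E] [NormedSpace ℝ E] [FiniteDimensional ℝ E]
    {M : Type*} [TopologicalSpace M] [ChartedSpace E M] [IsManifold 𝓘(ℝ, E) ∞ M]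
    [T2Space M] [ParacompactSpace M]
    {F : Type*} [NormedAddCommGroup F] [NormedSpace ℝ F] [FiniteDimensional ℝ F]
    {G : Type*} [TopologicalSpace G] [ChartedSpace F G] [Group G] [LieGroup 𝓘(ℝ, F) ∞ G]
    [T2Space G] [ParacompactSpace G]
    [MulAction G M] [ContMDiffSMul 𝓘(ℝ, F) 𝓘(ℝ, E) ∞ G M]
    (Ω : SymplecticReduction.SymplecticForm E M) (hΩ : Ω.IsSymplecticAction G)
    (μ : SymplecticReduction.MomentMap Ω F G)
    (N : Set M) (hN : N = μ.zeroLocus)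
    (hI : μ.momentumIdeal = SymplecticReduction.vanishingIdeal E N) :
    ∃ (P : SymplecticReduction.PoissonBracket (SymplecticReduction.ACGReduction E G N))
      (Q : SymplecticReduction.PoissonBracket (SymplecticReduction.LInftyReduction Ω F G N)),
      (∀ f g : SymplecticReduction.invariants E M G,
        ∃ h : SymplecticReduction.invariants E M G,
          (h : SymplecticReduction.SmoothFun E M) = Ω.poisson f g ∧
          P.bracket (Ideal.Quotient.mk _ f) (Ideal.Quotient.mk _ g) = Ideal.Quotient.mk _ h) ∧
      (∀ f g : SymplecticReduction.reducibleObservables Ω F G N,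
        ∃ h : SymplecticReduction.reducibleObservables Ω F G N,
          (h : SymplecticReduction.SmoothFun E M) = Ω.poisson f g ∧
          Q.bracket (Ideal.Quotient.mk _ f) (Ideal.Quotient.mk _ g) = Ideal.Quotient.mk _ h) ∧
      ∃ φ : SymplecticReduction.ACGReduction E G N →ₐ[ℝ]
          SymplecticReduction.LInftyReduction Ω F G N,
        (∀ f : SymplecticReduction.invariants E M G,
          ∃ h : SymplecticReduction.reducibleObservables Ω F G N,
            (h : SymplecticReduction.SmoothFun E M) = f ∧
            φ (Ideal.Quotient.mk _ f) = Ideal.Quotient.mk _ h) ∧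
        (∀ a b : SymplecticReduction.ACGReduction E G N,
          φ (P.bracket a b) = Q.bracket (φ a) (φ b)) ∧
        Function.Injective φ ∧
        (Ω.firstClass N =
            (SymplecticReduction.invariants E M G : Set (SymplecticReduction.SmoothFun E M)) +
            (SymplecticReduction.vanishingIdeal E N : Set (SymplecticReduction.SmoothFun E M)) →
          Function.Bijective φ) := by
  open SymplecticReduction in
  -- The existential clauses on representatives determine both brackets and the map, as every class
  -- has a representative; the witnesses are `Ω.poisson f g` and `f`, carried into the subalgebras.
  exact ⟨acgPoissonBracket hΩ μ hI, lInftyPoissonBracket N μ,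
    fun f g => ⟨_, rfl, acgPoissonBracket_mk hΩ μ hI f g⟩,
    fun f g => ⟨_, rfl, lInftyPoissonBracket_mk μ f g⟩,
    acgToLInfty μ hI, fun f => ⟨_, rfl, acgToLInfty_mk μ hI f⟩, acgToLInfty_bracket hΩ μ hI,
    acgToLInfty_injective μ hI,
    fun hF => ⟨acgToLInfty_injective μ hI, acgToLInfty_surjective μ hI hF⟩⟩
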